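/- Let $(B,g_B)$ and $(F,g_F)$ be smooth pseudo-Riemannian manifolds (without boundary, of arbitrary signature) of dimensions $m$ and $k$, and let $c,w\in C^\infty(B)$ be strictly positive. Let $S_B$, $S_F$ and $S$ denote the scalar curvatures of $(B,g_B)$, of $(F,g_F)$, and of the base conformal warped product $(B\times F,\ g)$ with $$g=(c\circ\pi)^2\,\pi^*g_B+(w\circ\pi)^2\,\sigma^*g_F,$$ where $\pi:B\times F\to B$ and $\sigma:B\times F\to F$ are the projections. Here the curvature tensor of the Levi-Civita connection $\nabla$ is $R(X,Y)Z=\nabla_X\nabla_YZ-\nabla_Y\nabla_XZ-\nabla_{[X,Y]}Z$, the Ricci tensor is $\mathrm{Ric}(X,Y)=\operatorname{tr}\bigl(Z\mapsto R(Z,Y)X\bigr)$, and the scalar curvature is the metric trace of $\mathrm{Ric}$. Let $\Delta_B={\nabla^B}^i\nabla^B_i$ be the Laplace-Beltrami operator and $\nabla^B$ the gradient on $(B,g_B)$. Then at every point $(p,q)\in B\times F$ (with $S_F$ evaluated at $q$, $S$ at $(p,q)$, and all the other functions at $p$) $$ \begin{aligned} c^2S={}&S_B+S_F\,\frac{c^2}{w^2}-2(m-1)\frac{\Delta_Bc}{c}-2k\frac{\Delta_Bw}{w}-(m-4)(m-1)\frac{g_B(\nabla^Bc,\nabla^Bc)}{c^2}\\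 &-2k(m-2)\frac{g_B(\nabla^Bw,\nabla^Bc)}{wc}-k(k-1)\frac{g_B(\nabla^Bw,\nabla^Bw)}{w^2}. \end{aligned} $$ -/

import Mathlib

set_option maxSynthPendingDepth 3

open scoped Manifold ContDiff

noncomputable section

/-! ## Tensor calculus of a metric on an open piece of a finite-dimensional vector space

A metric on (an open piece of) the vector space `E`, in the coordinates given by `E` itself, is a
map `G : E → (E →L[ℝ] E →L[ℝ] ℝ)`.  All notions are evaluated at a point `y` near which `G` is
smooth, symmetric and nondegenerate.  They are written without indices: for a basis `b i` of `E`,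
`G y (b i) (b j)` is `g_ij` and `fderiv ℝ G y (b l) (b i) (b j)` is `∂_l g_ij`. -/
namespace LocalMetric

variable {E : Type*} [NormedAddCommGroup E] [NormedSpace ℝ E]

/-- In finite dimension a nondegenerate bilinear form identifies vectors with covectors, so that
`ContinuousLinearMap.inverse` below is a true inverse. -/
theorem isInvertible_of_nondegenerate [FiniteDimensional ℝ E]
    (b : E →L[ℝ] E →L[ℝ] ℝ) (hb : ∀ u, (∀ v, b u v = 0) → u = 0) :
    b.IsInvertible := by
  have hinj : Function.Injective (b : E →ₗ[ℝ] (E →L[ℝ] ℝ)) := by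
    rw [← LinearMap.ker_eq_bot, LinearMap.ker_eq_bot']
    intro u hu
    apply hb; intro v
    have : b u = 0 := hu
    simp [this]
  have hd : Module.finrank ℝ E = Module.finrank ℝ (E →L[ℝ] ℝ) := by
    rw [← (LinearMap.toContinuousLinearMap : (E →ₗ[ℝ] ℝ) ≃ₗ[ℝ] (E →L[ℝ] ℝ)).finrank_eq]
    exact (Subspace.dual_finrank_eq (K := ℝ) (V := E)).symm
  refine ⟨(LinearEquiv.ofInjectiveOfFinrankEq (b : E →ₗ[ℝ] (E →L[ℝ] ℝ)) hinj
    hd).toContinuousLinearEquiv, ?_⟩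
  ext u v
  rfl

/-- The covector valued Christoffel symbols of the first kind,
`christoffelFirst G y u v z = (∂_u G(v, z) + ∂_v G(u, z) - ∂_z G(u, v)) / 2`. -/
def christoffelFirst (G : E → E →L[ℝ] E →L[ℝ] ℝ) (y : E) : E →L[ℝ] E →L[ℝ] E →L[ℝ] ℝ :=
  (1 / 2 : ℝ) • (fderiv ℝ G y + (fderiv ℝ G y).flip
    - ((ContinuousLinearMap.flipₗᵢ ℝ E E ℝ).toContinuousLinearEquiv :
        (E →L[ℝ] E →L[ℝ] ℝ) →L[ℝ] (E →L[ℝ] E →L[ℝ] ℝ)) ∘L (fderiv ℝ G y).flip)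

theorem christoffelFirst_apply (G : E → E →L[ℝ] E →L[ℝ] ℝ) (y u v z : E) :
    christoffelFirst G y u v z =
      (fderiv ℝ G y u v z + fderiv ℝ G y v u z - fderiv ℝ G y z u v) / 2 := by
  simp [christoffelFirst]; ring

/-- The Christoffel symbols `Γ(u, v)` of the Levi-Civita connection: `christoffel G y u v` is the
vector that corresponds to the covector `christoffelFirst G y u v` under `G y`.  For constant
vector fields `u`, `v` this is `∇_u v` at `y`. -/
def christoffel (G : E → E →L[ℝ] E →L[ℝ] ℝ) (y : E) : E →L[ℝ] E →L[ℝ] E :=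
  (ContinuousLinearMap.compL ℝ E (E →L[ℝ] ℝ) E (G y).inverse) ∘L (christoffelFirst G y)

theorem apply_christoffel (G : E → E →L[ℝ] E →L[ℝ] ℝ) (y u v z : E) (h : (G y).IsInvertible) :
    G y (christoffel G y u v) z =
      (fderiv ℝ G y u v z + fderiv ℝ G y v u z - fderiv ℝ G y z u v) / 2 := by
  rw [← christoffelFirst_apply]
  exact congrArg (fun L => L z) (h.self_apply_inverse (christoffelFirst G y u v))

/-- The Riemann curvature tensor `R(u, v) z = ∇_u ∇_v z - ∇_v ∇_u z - ∇_[u,v] z`. -/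
def curvature (G : E → E →L[ℝ] E →L[ℝ] ℝ) (y u v z : E) : E :=
  fderiv ℝ (christoffel G) y u v z - fderiv ℝ (christoffel G) y v u z
    + christoffel G y u (christoffel G y v z) - christoffel G y v (christoffel G y u z)

/-- The linear map `z ↦ R(z, v) u`, whose trace is the Ricci curvature `Ric(u, v)`. -/
def ricciEndomorphism (G : E → E →L[ℝ] E →L[ℝ] ℝ) (y u v : E) : E →ₗ[ℝ] E where
  toFun z := curvature G y z v u
  map_add' z z' := by simp [curvature]; abel
  map_smul' a z := by simp [curvature, smul_sub, smul_add]

/-- The Ricci tensor `Ric(u, v) = tr (z ↦ R(z, v) u)`, which in a `G y`-orthonormal basis `e i` is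
`∑ i, G(e i, e i) G(R(e i, v) u, e i)`. -/
def ricci (G : E → E →L[ℝ] E →L[ℝ] ℝ) (y : E) : E →ₗ[ℝ] E →ₗ[ℝ] ℝ :=
  LinearMap.mk₂ ℝ (fun u v => LinearMap.trace ℝ E (ricciEndomorphism G y u v))
    (fun u u' v => by
      rw [← map_add]; congr 1; ext z; simp [ricciEndomorphism, curvature]; abel)
    (fun a u v => by
      rw [← map_smul]; congr 1; ext z
      simp [ricciEndomorphism, curvature, smul_sub, smul_add])
    (fun u v v' => by
      rw [← map_add]; congr 1; ext z; simp [ricciEndomorphism, curvature]; abel)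
    (fun a u v => by
      rw [← map_smul]; congr 1; ext z
      simp [ricciEndomorphism, curvature, smul_sub, smul_add])

/-- The second covariant differential `H(u, v) = ∂_u ∂_v f - ∂_{Γ(u, v)} f` of a function `f`. -/
def hessian (G : E → E →L[ℝ] E →L[ℝ] ℝ) (f : E → ℝ) (y : E) : E →ₗ[ℝ] E →ₗ[ℝ] ℝ :=
  LinearMap.mk₂ ℝ (fun u v => fderiv ℝ (fderiv ℝ f) y u v - fderiv ℝ f y (christoffel G y u v))
    (fun u u' v => by simp; ring)
    (fun a u v => by simp; ring)
    (fun u v v' => by simp; ring)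
    (fun a u v => by simp; ring)

/-- The trace `g^ij T_ij` of a bilinear form `T` with respect to a nondegenerate bilinear form `g`:
the trace of the endomorphism `A` with `g (A u) v = T u v`. -/
def metricTrace [FiniteDimensional ℝ E] (g : E →L[ℝ] E →L[ℝ] ℝ) (T : E →ₗ[ℝ] E →ₗ[ℝ] ℝ) : ℝ :=
  LinearMap.trace ℝ E
    ((g.inverse : (E →L[ℝ] ℝ) →ₗ[ℝ] E) ∘ₗ
      (LinearMap.toContinuousLinearMap : (E →ₗ[ℝ] ℝ) ≃ₗ[ℝ] (E →L[ℝ] ℝ)).toLinearMap ∘ₗ T)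

/-- The scalar curvature `g^ij Ric_ij`. -/
def scalarCurvature [FiniteDimensional ℝ E] (G : E → E →L[ℝ] E →L[ℝ] ℝ) (y : E) : ℝ :=
  metricTrace (G y) (ricci G y)

/-- The Laplace-Beltrami operator `∇^i ∇_i f`. -/
def laplacian [FiniteDimensional ℝ E] (G : E → E →L[ℝ] E →L[ℝ] ℝ) (f : E → ℝ) (y : E) : ℝ :=
  metricTrace (G y) (hessian G f y)

end LocalMetric

/-- The pull-back of a continuous bilinear form along a continuous linear map. -/
def pullbackForm {V W : Type*} [AddCommGroup V] [Module ℝ V] [TopologicalSpace V]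
    [AddCommGroup W] [Module ℝ W] [TopologicalSpace W]
    (A : W →L[ℝ] V) (b : V →L[ℝ] V →L[ℝ] ℝ) : W →L[ℝ] W →L[ℝ] ℝ :=
  (ContinuousLinearMap.precomp ℝ A) ∘L b ∘L A

@[simp]
theorem pullbackForm_apply {V W : Type*} [AddCommGroup V] [Module ℝ V] [TopologicalSpace V]
    [AddCommGroup W] [Module ℝ W] [TopologicalSpace W]
    (A : W →L[ℝ] V) (b : V →L[ℝ] V →L[ℝ] ℝ) (u v : W) :
    pullbackForm A b u v = b (A u) (A v) := rfl

/-- A smooth pseudo-Riemannian metric on a manifold without boundary: a smooth field of symmetric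
nondegenerate bilinear forms (of any signature) on the tangent spaces. -/
structure PseudoRiemannianMetric {E : Type*} [NormedAddCommGroup E] [NormedSpace ℝ E]
    {H : Type*} [TopologicalSpace H] (I : ModelWithCorners ℝ E H) [I.Boundaryless]
    (M : Type*) [TopologicalSpace M] [ChartedSpace H M] [IsManifold I ∞ M] where
  /-- The bilinear form on the tangent space at `x`. -/
  form (x : M) : TangentSpace I x →L[ℝ] TangentSpace I x →L[ℝ] ℝ
  symm (x : M) (u v : TangentSpace I x) : form x u v = form x v u
  nondegenerate (x : M) (u : TangentSpace I x) (hu : ∀ v, form x u v = 0) : u = 0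
  contMDiff : ContMDiff I (I.prod 𝓘(ℝ, E →L[ℝ] E →L[ℝ] ℝ)) ∞
    (fun x => Bundle.TotalSpace.mk' (E →L[ℝ] E →L[ℝ] ℝ)
      (E := fun x : M => TangentSpace I x →L[ℝ] TangentSpace I x →L[ℝ] ℝ) x (form x))

namespace PseudoRiemannianMetric

section Operators

variable {E : Type*} [NormedAddCommGroup E] [NormedSpace ℝ E] [FiniteDimensional ℝ E]
  {H : Type*} [TopologicalSpace H] {I : ModelWithCorners ℝ E H} [I.Boundaryless]
  {M : Type*} [TopologicalSpace M] [ChartedSpace H M] [IsManifold I ∞ M]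

/-- The metric in the preferred chart around `x`: its pull-back along the inverse of the chart. -/
def inChart (g : PseudoRiemannianMetric I M) (x : M) (y : E) : E →L[ℝ] E →L[ℝ] ℝ :=
  pullbackForm (V := TangentSpace I ((extChartAt I x).symm y)) (W := E)
    (mfderiv 𝓘(ℝ, E) I (extChartAt I x).symm y) (g.form ((extChartAt I x).symm y))

/-- The scalar curvature at `x`, computed in the preferred chart around `x` (its value does not
depend on the chart). -/
def scalarCurvature (g : PseudoRiemannianMetric I M) (x : M) : ℝ :=
  LocalMetric.scalarCurvature (g.inChart x) (extChartAt I x x)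

/-- The Laplace-Beltrami operator at `x`, computed in the preferred chart around `x` (its
value does not depend on the chart). -/
def laplacian (g : PseudoRiemannianMetric I M) (f : M → ℝ) (x : M) : ℝ :=
  LocalMetric.laplacian (g.inChart x) (f ∘ (extChartAt I x).symm) (extChartAt I x x)

/-- The gradient of `f`: the vector field with `g (grad f, v) = df v`. -/
def gradient (g : PseudoRiemannianMetric I M) (f : M → ℝ) (x : M) : TangentSpace I x :=
  (g.form x).inverse (mfderiv I 𝓘(ℝ, ℝ) f x)

theorem gradient_spec (g : PseudoRiemannianMetric I M) (f : M → ℝ) (x : M)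
    (v : TangentSpace I x) : g.form x (g.gradient f x) v = mfderiv I 𝓘(ℝ, ℝ) f x v := by
  have h : (g.form x).IsInvertible := LocalMetric.isInvertible_of_nondegenerate (E := E) (g.form x) (g.nondegenerate x)
  have := h.self_apply_inverse (mfderiv I 𝓘(ℝ, ℝ) f x)
  unfold gradient
  exact congrArg (fun L : TangentSpace I x →L[ℝ] ℝ => L v) this

end Operators

section BaseConformalWarpedProduct

variable {E : Type*} [NormedAddCommGroup E] [NormedSpace ℝ E]
  {H : Type*} [TopologicalSpace H] {I : ModelWithCorners ℝ E H} [I.Boundaryless]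
  {B : Type*} [TopologicalSpace B] [ChartedSpace H B] [IsManifold I ∞ B]
  {E' : Type*} [NormedAddCommGroup E'] [NormedSpace ℝ E']
  {H' : Type*} [TopologicalSpace H'] {J : ModelWithCorners ℝ E' H'} [J.Boundaryless]
  {F : Type*} [TopologicalSpace F] [ChartedSpace H' F] [IsManifold J ∞ F]

/-- The bilinear form `c² π^* g_B + w² σ^* g_F` at the point `x` of `B × F`, where `π` and `σ` are
the projections to `B` and `F`. -/
def bcwpForm (gB : PseudoRiemannianMetric I B) (gF : PseudoRiemannianMetric J F) (c w : B → ℝ)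
    (x : B × F) : TangentSpace (I.prod J) x →L[ℝ] TangentSpace (I.prod J) x →L[ℝ] ℝ :=
  (c x.1) ^ 2 • pullbackForm (mfderiv (I.prod J) I Prod.fst x) (gB.form x.1)
    + (w x.1) ^ 2 • pullbackForm (mfderiv (I.prod J) J Prod.snd x) (gF.form x.2)

set_option linter.unusedSectionVars false in
theorem contMDiff_pullbackForm (gB : PseudoRiemannianMetric I B) {f : F → B}
    (hf : ContMDiff J I ∞ f) :
    ContMDiff J (J.prod 𝓘(ℝ, E' →L[ℝ] E' →L[ℝ] ℝ)) ∞
    (fun x => Bundle.TotalSpace.mk' (E' →L[ℝ] E' →L[ℝ] ℝ)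
      (E := fun x : F => TangentSpace J x →L[ℝ] TangentSpace J x →L[ℝ] ℝ) x
        (pullbackForm (mfderiv J I f x) (gB.form (f x)))) := by
  intro x₀
  rw [contMDiffAt_hom_bundle]
  refine ⟨contMDiffAt_id, ?_⟩
  have h1 := (hf x₀).mfderiv_const (m := ∞) le_rfl
  have h2 := ((contMDiffAt_hom_bundle _).1 (gB.contMDiff (f x₀))).2.comp x₀ (hf x₀)
  have h3 := (h1.clm_precomp (F₃ := ℝ)).clm_comp (h2.clm_comp h1)
  refine h3.congr_of_eventuallyEq ?_
  have A : ∀ᶠ m in nhds x₀, m ∈ (trivializationAt E' (TangentSpace J) x₀).baseSet :=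
    (trivializationAt E' (TangentSpace J) x₀).open_baseSet.mem_nhds
      (FiberBundle.mem_baseSet_trivializationAt' x₀)
  have A' : ∀ᶠ m in nhds x₀, f m ∈ (trivializationAt E (TangentSpace I) (f x₀)).baseSet :=
    hf.continuous.continuousAt ((trivializationAt E (TangentSpace I) (f x₀)).open_baseSet.mem_nhds
      (FiberBundle.mem_baseSet_trivializationAt' (f x₀)))
  filter_upwards [A, A'] with m hm hm'
  ext u v
  rw [inCoordinates_apply_eq₂ hm hm (by simp)]
  change _ = (ContinuousLinearMap.inCoordinates E (TangentSpace I) (E →L[ℝ] ℝ)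
    (fun b => TangentSpace I b →L[ℝ] ℝ) (f x₀) (f m) (f x₀) (f m) (gB.form (f m)))
      (ContinuousLinearMap.inCoordinates E' (TangentSpace J) E (TangentSpace I) x₀ m (f x₀) (f m)
              (mfderiv J I f m) u)
      (ContinuousLinearMap.inCoordinates E' (TangentSpace J) E (TangentSpace I) x₀ m (f x₀) (f m)
              (mfderiv J I f m) v)
  rw [inCoordinates_apply_eq₂ hm' hm' (by simp), ContinuousLinearMap.inCoordinates_eq hm hm']
  have key (z : TangentSpace I (f m)) :
      (trivializationAt E (TangentSpace I) (f x₀)).symm (f m)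
        ((trivializationAt E (TangentSpace I) (f x₀)) ⟨f m, z⟩).2 = z :=
    (trivializationAt E (TangentSpace I) (f x₀)).symm_apply_apply_mk hm' z
  simp
  erw [key, key]

theorem bcwpForm_apply (gB : PseudoRiemannianMetric I B) (gF : PseudoRiemannianMetric J F)
    (c w : B → ℝ) (x : B × F) (u v : TangentSpace (I.prod J) x) :
    bcwpForm gB gF c w x u v =
      (c x.1) ^ 2 * gB.form x.1 (mfderiv (I.prod J) I Prod.fst x u)
        (mfderiv (I.prod J) I Prod.fst x v)
      + (w x.1) ^ 2 * gF.form x.2 (mfderiv (I.prod J) J Prod.snd x u)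
        (mfderiv (I.prod J) J Prod.snd x v) := rfl

/-- The base conformal warped product metric `g = c² g_B ⊕ w² g_F` on `B × F`. -/
def bcwp (gB : PseudoRiemannianMetric I B) (gF : PseudoRiemannianMetric J F) (c w : B → ℝ)
    (hc : ContMDiff I 𝓘(ℝ, ℝ) ∞ c) (hw : ContMDiff I 𝓘(ℝ, ℝ) ∞ w)
    (hc0 : ∀ p, 0 < c p) (hw0 : ∀ p, 0 < w p) : PseudoRiemannianMetric (I.prod J) (B × F) where
  form := bcwpForm gB gF c w
  symm x u v := by
    rw [bcwpForm_apply, bcwpForm_apply, gB.symm x.1, gF.symm x.2]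
  nondegenerate x u hu := by
    have h1 : mfderiv (I.prod J) I Prod.fst x u = 0 := by
      apply gB.nondegenerate
      intro v
      let V : TangentSpace (I.prod J) x := (v, 0)
      have e1 : mfderiv (I.prod J) I Prod.fst x V = v := by
        rw [mfderiv_fst]; rfl
      have e2 : mfderiv (I.prod J) J Prod.snd x V = 0 := by
        rw [mfderiv_snd]; rfl
      have h := (bcwpForm_apply gB gF c w x u V).symm.trans (hu V)
      rw [e1, e2, map_zero, mul_zero] at h
      simpa only [add_zero, mul_eq_zero, pow_eq_zero_iff two_ne_zero, (hc0 _).ne', false_or] using h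
    have h2 : mfderiv (I.prod J) J Prod.snd x u = 0 := by
      apply gF.nondegenerate
      intro v
      let V : TangentSpace (I.prod J) x := (0, v)
      have e1 : mfderiv (I.prod J) I Prod.fst x V = 0 := by
        rw [mfderiv_fst]; rfl
      have e2 : mfderiv (I.prod J) J Prod.snd x V = v := by
        rw [mfderiv_snd]; rfl
      have h := (bcwpForm_apply gB gF c w x u V).symm.trans (hu V)
      rw [e1, e2, map_zero, mul_zero] at h
      simpa only [zero_add, mul_eq_zero, pow_eq_zero_iff two_ne_zero, (hw0 _).ne', false_or] using h
    rw [mfderiv_fst] at h1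
    rw [mfderiv_snd] at h2
    exact Prod.ext h1 h2
  contMDiff := by
    have h1 : ContMDiff (I.prod J) 𝓘(ℝ, ℝ) ∞ (fun x : B × F => (c x.1) ^ 2) :=
      (hc.comp contMDiff_fst).pow 2
    have h2 : ContMDiff (I.prod J) 𝓘(ℝ, ℝ) ∞ (fun x : B × F => (w x.1) ^ 2) :=
      (hw.comp contMDiff_fst).pow 2
    exact (h1.smul_section (contMDiff_pullbackForm gB contMDiff_fst)).add_section
      (h2.smul_section (contMDiff_pullbackForm gF contMDiff_snd))

end BaseConformalWarpedProduct

end PseudoRiemannianMetric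

end

/-! The metric c² g_B + w² g_F is an ordinary warped product with warping function w over the base
whose metric has been conformally changed to c² g_B. So two classical formulas suffice. For f = log
c and n = dim B, the conformal one reads e^(2f) S = S_B - 2(n-1) Δf - (n-1)(n-2)|∇f|²
(`scalarCurvature_conformal`). The warped one gives S as S_base + w⁻² S_F - 2k w⁻¹ Δw - k(k-1) w⁻²
|∇w|², with base operators (`scalarCurvature_warped`).

Applying the second over the changed base also requires Δw and |∇w|² for c² g_B
(`laplacian_conformal`, `gradient_conformal`); rewriting Δ(log c) in terms of c (`laplacian_log`)
then leaves only algebra.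

Both formulas are proved in coordinates and without bases. The Koszul formula gives a closed
expression for the Christoffel map. It holds on a neighbourhood, hence can be differentiated to give
the curvature, and traces are found by exhibiting the endomorphism that represents a bilinear form.
The passage to manifolds uses that the preferred chart of a product is the product of the charts, so
that the metric in this chart coincides near the point with the local model
(`inChart_bcwp_eventuallyEq`). -/

noncomputable section

open Filter Topology

namespace LocalMetric

/-! ### Metric traces without bases. -/

section Trace

variable {E : Type*} [NormedAddCommGroup E] [NormedSpace ℝ E]

theorem eq_of_form_eq {g : E →L[ℝ] E →L[ℝ] ℝ} (hg : g.IsInvertible) {x y : E}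
    (h : ∀ v, g x v = g y v) : x = y :=
  hg.injective (ContinuousLinearMap.ext h)

variable [FiniteDimensional ℝ E]

/-- The endomorphism `A` with `g (A u) v = T u v`. -/
def raise (g : E →L[ℝ] E →L[ℝ] ℝ) (T : E →ₗ[ℝ] E →ₗ[ℝ] ℝ) : E →ₗ[ℝ] E :=
  (g.inverse : (E →L[ℝ] ℝ) →ₗ[ℝ] E) ∘ₗ
    (LinearMap.toContinuousLinearMap : (E →ₗ[ℝ] ℝ) ≃ₗ[ℝ] (E →L[ℝ] ℝ)).toLinearMap ∘ₗ T

theorem metricTrace_eq_trace_raise (g : E →L[ℝ] E →L[ℝ] ℝ) (T : E →ₗ[ℝ] E →ₗ[ℝ] ℝ) :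
    metricTrace g T = LinearMap.trace ℝ E (raise g T) := rfl

theorem apply_raise {g : E →L[ℝ] E →L[ℝ] ℝ} (hg : g.IsInvertible) (T : E →ₗ[ℝ] E →ₗ[ℝ] ℝ)
    (u v : E) : g (raise g T u) v = T u v :=
  congrArg (fun L : E →L[ℝ] ℝ => L v) (hg.self_apply_inverse _)

/-- By nondegeneracy the representing endomorphism is unique. Every metric trace below is computed
by guessing it and lowering an index to check the guess. -/
theorem metricTrace_eq_trace {g : E →L[ℝ] E →L[ℝ] ℝ} (hg : g.IsInvertible)
    {T : E →ₗ[ℝ] E →ₗ[ℝ] ℝ} {A : E →ₗ[ℝ] E} (h : ∀ u v, g (A u) v = T u v) :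
    metricTrace g T = LinearMap.trace ℝ E A := by
  rw [metricTrace_eq_trace_raise]
  congr 1
  ext u
  exact eq_of_form_eq hg fun v => by rw [apply_raise hg, h]

end Trace

/-! ### Levi-Civita calculus of a local metric. -/

section Basic

variable {E : Type*} [NormedAddCommGroup E] [NormedSpace ℝ E]

theorem christoffel_congr {G G' : E → E →L[ℝ] E →L[ℝ] ℝ} {y : E} (h : G =ᶠ[𝓝 y] G') :
    christoffel G y = christoffel G' y := by
  simp only [christoffel, christoffelFirst, h.eq_of_nhds, h.fderiv_eq]

/-- Curvature depends only on the germ of the metric. This permits replacing a metric read in a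
chart by an explicit model that agrees with it only near the point. -/
theorem scalarCurvature_congr [FiniteDimensional ℝ E] {G G' : E → E →L[ℝ] E →L[ℝ] ℝ} {y : E}
    (h : G =ᶠ[𝓝 y] G') : scalarCurvature G y = scalarCurvature G' y := by
  have hΓ : christoffel G =ᶠ[𝓝 y] christoffel G' :=
    h.eventually_nhds.mono fun _ hx => christoffel_congr hx
  have hR : ricci G y = ricci G' y := by
    ext u v
    change LinearMap.trace ℝ E _ = LinearMap.trace ℝ E _
    congr 1
    ext z
    simp only [ricciEndomorphism, curvature, LinearMap.coe_mk, AddHom.coe_mk, hΓ.fderiv_eq,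
      hΓ.eq_of_nhds]
  rw [scalarCurvature, scalarCurvature, hR, h.eq_of_nhds]

/-- `G` is a twice continuously differentiable pseudo-Riemannian metric near `y`. -/
structure IsMetricAt (G : E → E →L[ℝ] E →L[ℝ] ℝ) (y : E) : Prop where
  contDiffAt : ContDiffAt ℝ 2 G y
  symm : ∀ᶠ x in 𝓝 y, ∀ u v, G x u v = G x v u
  isInvertible : (G y).IsInvertible

/-- The gradient of `f` with respect to `G`. -/
def gradient (G : E → E →L[ℝ] E →L[ℝ] ℝ) (f : E → ℝ) (y : E) : E :=
  (G y).inverse (fderiv ℝ f y)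

namespace IsMetricAt

variable {G : E → E →L[ℝ] E →L[ℝ] ℝ} {y : E}

theorem apply_gradient (h : IsMetricAt G y) (f : E → ℝ) (v : E) :
    G y (gradient G f y) v = fderiv ℝ f y v :=
  congrArg (fun L : E →L[ℝ] ℝ => L v) (h.isInvertible.self_apply_inverse _)

theorem symm_apply (h : IsMetricAt G y) (u v : E) : G y u v = G y v u :=
  h.symm.self_of_nhds u v

theorem apply_gradient' (h : IsMetricAt G y) (f : E → ℝ) (v : E) :
    G y v (gradient G f y) = fderiv ℝ f y v := by
  rw [h.symm_apply, h.apply_gradient]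

theorem differentiableAt (h : IsMetricAt G y) : DifferentiableAt ℝ G y :=
  h.contDiffAt.differentiableAt (by norm_num)

theorem fderiv_symm (h : IsMetricAt G y) (z u v : E) :
    fderiv ℝ G y z u v = fderiv ℝ G y z v u := by
  have e : (fun x => G x u v) =ᶠ[𝓝 y] fun x => G x v u := h.symm.mono fun x hx => hx u v
  have key (u v : E) : fderiv ℝ (fun x => G x u v) y z = fderiv ℝ G y z u v := by
    have := (h.differentiableAt.hasFDerivAt.clm_apply (hasFDerivAt_const u y)).clm_apply
      (hasFDerivAt_const v y)
    rw [this.fderiv]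
    simp
  rw [← key, ← key, e.fderiv_eq]

theorem apply_christoffel (h : IsMetricAt G y) (u v z : E) :
    G y (christoffel G y u v) z =
      (fderiv ℝ G y u v z + fderiv ℝ G y v u z - fderiv ℝ G y z u v) / 2 :=
  LocalMetric.apply_christoffel G y u v z h.isInvertible

/-- The Levi-Civita connection is compatible with the metric. -/
theorem fderiv_eq (h : IsMetricAt G y) (z u v : E) :
    fderiv ℝ G y z u v = G y (christoffel G y z u) v + G y u (christoffel G y z v) := by
  rw [h.symm_apply u, h.apply_christoffel, h.apply_christoffel, h.fderiv_symm z v u,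
    h.fderiv_symm u z v, h.fderiv_symm v z u]
  ring

theorem christoffel_symm (h : IsMetricAt G y) (u v : E) :
    christoffel G y u v = christoffel G y v u :=
  eq_of_form_eq h.isInvertible fun z => by
    rw [h.apply_christoffel, h.apply_christoffel, h.fderiv_symm z u v]
    ring

theorem hessian_symm (h : IsMetricAt G y) {f : E → ℝ} (hf : ContDiffAt ℝ 2 f y) (u v : E) :
    hessian G f y u v = hessian G f y v u := by
  change fderiv ℝ (fderiv ℝ f) y u v - _ = fderiv ℝ (fderiv ℝ f) y v u - _
  rw [h.christoffel_symm u v, (hf.isSymmSndFDerivAt (by simp)).eq u v]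

variable [FiniteDimensional ℝ E]

/-- Invertible operators form an open set. Identities proved at one point therefore hold nearby and
may be differentiated. -/
theorem eventually (h : IsMetricAt G y) : ∀ᶠ x in 𝓝 y, IsMetricAt G x := by
  have h1 : ∀ᶠ x in 𝓝 y, (G x).IsInvertible := by
    obtain ⟨e, he⟩ := h.isInvertible
    have := FiniteDimensional.complete ℝ E
    have := h.contDiffAt.continuousAt.eventually (he ▸ ContinuousLinearEquiv.nhds e)
    exact this
  filter_upwards [h1, h.contDiffAt.eventually (by norm_num), h.symm.eventually_nhds]
    with x h1 h2 h3 using ⟨h2, h3, h1⟩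

theorem differentiableAt_inverse (h : IsMetricAt G y) :
    DifferentiableAt ℝ (fun x => (G x).inverse) y := by
  have := FiniteDimensional.complete ℝ E
  exact ((h.isInvertible.contDiffAt_map_inverse (n := 1)).differentiableAt (by norm_num)).comp y
    h.differentiableAt

theorem differentiableAt_christoffel (h : IsMetricAt G y) :
    DifferentiableAt ℝ (christoffel G) y := by
  have h1 : DifferentiableAt ℝ (fderiv ℝ G) y :=
    (h.contDiffAt.fderiv_right (m := 1) (by norm_num)).differentiableAt (by norm_num)
  have h2 : DifferentiableAt ℝ (christoffelFirst G) y := by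
    unfold christoffelFirst
    have h3 : DifferentiableAt ℝ (fun x => (fderiv ℝ G x).flip) y :=
      (ContinuousLinearMap.flipₗᵢ ℝ E E (E →L[ℝ] ℝ)).differentiableAt.comp y h1
    exact ((h1.add h3).sub ((differentiableAt_const _).clm_comp h3)).const_smul (1 / 2 : ℝ)
  unfold christoffel
  exact ((ContinuousLinearMap.differentiableAt _).comp y h.differentiableAt_inverse).clm_comp h2

theorem differentiableAt_gradient (h : IsMetricAt G y) {f : E → ℝ} (hf : ContDiffAt ℝ 2 f y) :
    DifferentiableAt ℝ (gradient G f) y :=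
  h.differentiableAt_inverse.clm_apply
    ((hf.fderiv_right (m := 1) (by norm_num)).differentiableAt (by norm_num))

/-- Freezing the two vector arguments lets a closed formula for Γ(v, z) be differentiated as a
function of the point alone. -/
theorem fderiv_christoffel_apply (h : IsMetricAt G y) (u v z : E) :
    fderiv ℝ (christoffel G) y u v z = fderiv ℝ (fun x => christoffel G x v z) y u := by
  have := (h.differentiableAt_christoffel.hasFDerivAt.clm_apply (hasFDerivAt_const v y)).clm_apply
    (hasFDerivAt_const z y)
  rw [this.fderiv]
  simp

/-- The covariant derivative of the gradient is the Hessian. -/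
theorem apply_fderiv_gradient (h : IsMetricAt G y) {f : E → ℝ} (hf : ContDiffAt ℝ 2 f y)
    (u v : E) :
    G y (fderiv ℝ (gradient G f) y u + christoffel G y u (gradient G f y)) v =
      hessian G f y u v := by
  have e : (fun x => G x (gradient G f x) v) =ᶠ[𝓝 y] fun x => fderiv ℝ f x v :=
    h.eventually.mono fun x hx => hx.apply_gradient f v
  have hd : DifferentiableAt ℝ (fderiv ℝ f) y :=
    (hf.fderiv_right (m := 1) (by norm_num)).differentiableAt (by norm_num)
  have h1 := (h.differentiableAt.hasFDerivAt.clm_apply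
    (h.differentiableAt_gradient hf).hasFDerivAt).clm_apply (hasFDerivAt_const v y)
  have h2 := hd.hasFDerivAt.clm_apply (hasFDerivAt_const v y)
  -- Differentiate G(∇f, v) = df(v) along u. Metric compatibility splits the derivative of G into
  -- G(Γ(u, ∇f), v) and G(∇f, Γ(u, v)) = df(Γ(u, v)); the latter completes the Hessian.
  have h3 := congrArg (fun L : E →L[ℝ] ℝ => L u) e.fderiv_eq
  rw [h1.fderiv, h2.fderiv] at h3
  simp [h.fderiv_eq] at h3
  change _ = fderiv ℝ (fderiv ℝ f) y u v - fderiv ℝ f y (christoffel G y u v)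
  rw [← h3, map_add, ← h.apply_gradient f]
  simp
  ring

theorem fderiv_gradient (h : IsMetricAt G y) {f : E → ℝ} (hf : ContDiffAt ℝ 2 f y) (u : E) :
    fderiv ℝ (gradient G f) y u + christoffel G y u (gradient G f y) =
      raise (G y) (hessian G f y) u :=
  eq_of_form_eq h.isInvertible fun v => by
    rw [h.apply_fderiv_gradient hf, apply_raise h.isInvertible]

end IsMetricAt

end Basic

end LocalMetric

namespace LocalMetric

/-! ### Rescaling a bilinear form by a constant. -/

section Scaling

variable {E : Type*} [NormedAddCommGroup E] [NormedSpace ℝ E]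

theorem isInvertible_smul {g : E →L[ℝ] E →L[ℝ] ℝ} (hg : g.IsInvertible) {s : ℝ} (hs : s ≠ 0) :
    (s • g).IsInvertible :=
  ContinuousLinearMap.IsInvertible.of_inverse (g := s⁻¹ • g.inverse)
    (by simp [hg.self_comp_inverse, smul_smul, hs]) (by simp [hg.inverse_comp_self, smul_smul, hs])

theorem inverse_smul_apply {g : E →L[ℝ] E →L[ℝ] ℝ} (hg : g.IsInvertible) {s : ℝ} (hs : s ≠ 0)
    (L : E →L[ℝ] ℝ) : (s • g).inverse L = s⁻¹ • g.inverse L := by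
  apply (isInvertible_smul hg hs).injective
  rw [(isInvertible_smul hg hs).self_apply_inverse]
  simp [hg.self_apply_inverse, smul_smul, hs]

theorem metricTrace_smul [FiniteDimensional ℝ E] {g : E →L[ℝ] E →L[ℝ] ℝ} (hg : g.IsInvertible)
    {s : ℝ} (hs : s ≠ 0) (T : E →ₗ[ℝ] E →ₗ[ℝ] ℝ) :
    metricTrace (s • g) T = s⁻¹ * metricTrace g T := by
  rw [metricTrace_eq_trace (isInvertible_smul hg hs) (A := s⁻¹ • raise g T), map_smul, smul_eq_mul,
    metricTrace_eq_trace_raise]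
  intro u v
  simp [apply_raise hg, hs]

end Scaling

/-! ### Conformal change of the metric. -/

section Conformal

variable {E : Type*} [NormedAddCommGroup E] [NormedSpace ℝ E]

/-- The metric `e^(2f) G`. -/
def conformal (G : E → E →L[ℝ] E →L[ℝ] ℝ) (f : E → ℝ) (y : E) : E →L[ℝ] E →L[ℝ] ℝ :=
  (Real.exp (f y)) ^ 2 • G y

variable {G : E → E →L[ℝ] E →L[ℝ] ℝ} {f : E → ℝ} {y : E}

theorem IsMetricAt.conformal (h : IsMetricAt G y) (hf : ContDiffAt ℝ 2 f y) :
    IsMetricAt (conformal G f) y where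
  contDiffAt := (hf.exp.pow 2).smul h.contDiffAt
  symm := h.symm.mono fun x hx u v => by simp [LocalMetric.conformal, hx u v]
  isInvertible := isInvertible_smul h.isInvertible (by positivity)

theorem gradient_conformal (h : IsMetricAt G y) (k : E → ℝ) :
    gradient (conformal G f) k y = ((Real.exp (f y)) ^ 2)⁻¹ • gradient G k y :=
  inverse_smul_apply h.isInvertible (by positivity) _

theorem fderiv_conformal (h : IsMetricAt G y) (hf : DifferentiableAt ℝ f y) (z u v : E) :
    fderiv ℝ (conformal G f) y z u v =
      (Real.exp (f y)) ^ 2 * (2 * fderiv ℝ f y z * G y u v + fderiv ℝ G y z u v) := by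
  have := (hf.hasFDerivAt.exp.pow 2).smul h.differentiableAt.hasFDerivAt
  unfold conformal
  erw [this.fderiv]
  simp
  ring

/-- In the Koszul formula the factor e^(2f) contributes 2 df ⊗ G to each of the three derivatives;
dividing by e^(2f) leaves a correction linear in df. -/
theorem christoffel_conformal (h : IsMetricAt G y) (hf : ContDiffAt ℝ 2 f y) (u v : E) :
    christoffel (conformal G f) y u v = christoffel G y u v + fderiv ℝ f y u • v
      + fderiv ℝ f y v • u - G y u v • gradient G f y := by
  have hd : DifferentiableAt ℝ f y := hf.differentiableAt (by norm_num)
  refine eq_of_form_eq (h.conformal hf).isInvertible fun z => ?_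
  rw [(h.conformal hf).apply_christoffel]
  simp only [fderiv_conformal h hd]
  simp [conformal, h.apply_christoffel, h.apply_gradient]
  ring

variable [FiniteDimensional ℝ E]

/-- The new Hessian of k is the old one minus df ⊗ dk + dk ⊗ df plus dk(∇f) G. The traces of the
corrections are -2 and n times dk(∇f). -/
theorem laplacian_conformal (h : IsMetricAt G y) (hf : ContDiffAt ℝ 2 f y) {k : E → ℝ} :
    laplacian (conformal G f) k y = ((Real.exp (f y)) ^ 2)⁻¹ *
      (laplacian G k y + (Module.finrank ℝ E - 2) * fderiv ℝ k y (gradient G f y)) := by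
  unfold laplacian
  rw [conformal, metricTrace_smul h.isInvertible (by positivity),
    metricTrace_eq_trace (T := hessian _ _ _) h.isInvertible
    (A := raise (G y) (hessian G k y)
      - (fderiv ℝ f y : E →ₗ[ℝ] ℝ).smulRight (gradient G k y)
      - (fderiv ℝ k y : E →ₗ[ℝ] ℝ).smulRight (gradient G f y)
      + fderiv ℝ k y (gradient G f y) • LinearMap.id)]
  · have : fderiv ℝ k y (gradient G f y) = fderiv ℝ f y (gradient G k y) := by
      rw [← h.apply_gradient, h.apply_gradient']
    simp [LinearMap.trace_smulRight, ← metricTrace_eq_trace_raise, this]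
    ring
  · intro u v
    simp [apply_raise h.isInvertible, h.apply_gradient]
    simp [hessian]
    change _ = _ - fderiv ℝ k y (christoffel (conformal G f) y u v)
    rw [christoffel_conformal h hf]
    simp
    ring

theorem curvature_conformal (h : IsMetricAt G y) (hf : ContDiffAt ℝ 2 f y) (z v u : E) :
    curvature (conformal G f) y z v u = curvature G y z v u
      + hessian G f y z u • v - hessian G f y v u • z
      - G y v u • raise (G y) (hessian G f y) z + G y z u • raise (G y) (hessian G f y) v
      + (fderiv ℝ f y v * fderiv ℝ f y u
          - G y v u * fderiv ℝ f y (gradient G f y)) • z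
      - (fderiv ℝ f y z * fderiv ℝ f y u
          - G y z u * fderiv ℝ f y (gradient G f y)) • v
      + (fderiv ℝ f y z * G y v u - fderiv ℝ f y v * G y z u) • gradient G f y := by
  have hd : DifferentiableAt ℝ (fderiv ℝ f) y :=
    (hf.fderiv_right (m := 1) (by norm_num)).differentiableAt (by norm_num)
  -- The conformal Christoffel formula holds near y, so it is differentiated term by term.
  have key (z v u : E) : fderiv ℝ (christoffel (conformal G f)) y z v u =
      fderiv ℝ (christoffel G) y z v u + fderiv ℝ (fderiv ℝ f) y z v • u
      + fderiv ℝ (fderiv ℝ f) y z u • v - fderiv ℝ G y z v u • gradient G f y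
      - G y v u • fderiv ℝ (gradient G f) y z := by
    have e : (fun x => christoffel (conformal G f) x v u) =ᶠ[𝓝 y] fun x =>
        christoffel G x v u + fderiv ℝ f x v • u
        + fderiv ℝ f x u • v - G x v u • gradient G f x := by
      filter_upwards [h.eventually, hf.eventually (by norm_num)] with x hx hfx
        using christoffel_conformal hx hfx v u
    have h1 := (h.differentiableAt_christoffel.hasFDerivAt.clm_apply
      (hasFDerivAt_const v y)).clm_apply (hasFDerivAt_const u y)
    have h2 (v : E) := hd.hasFDerivAt.clm_apply (hasFDerivAt_const v y)
    have h3 := (h.differentiableAt.hasFDerivAt.clm_apply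
      (hasFDerivAt_const v y)).clm_apply (hasFDerivAt_const u y)
    have h4 := ((h1.add ((h2 v).smul (hasFDerivAt_const u y))).add
      ((h2 u).smul (hasFDerivAt_const v y))).sub
      (h3.smul (h.differentiableAt_gradient hf).hasFDerivAt)
    rw [(h.conformal hf).fderiv_christoffel_apply, e.fderiv_eq]
    erw [h4.fderiv]
    simp
    module
  -- Second partials become Hessians, derivatives of ∇f become raised Hessians, and derivatives of G
  -- become Christoffel terms. The non-tensorial remainder then cancels by the symmetry of Γ and of
  -- second derivatives.
  have hs := (hf.isSymmSndFDerivAt (by simp)).eq z v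
  have hH (z u : E) : fderiv ℝ (fderiv ℝ f) y z u =
      hessian G f y z u + fderiv ℝ f y (christoffel G y z u) := by simp [hessian]
  have hP (z : E) := eq_sub_of_add_eq (h.fderiv_gradient hf z)
  rw [curvature, curvature, key, key]
  simp only [christoffel_conformal h hf, hP, hs, h.fderiv_eq, map_add, map_sub, map_smul,
    smul_eq_mul, h.apply_gradient']
  simp only [hH, h.christoffel_symm v z, h.symm_apply v z]
  module

/-- As a function of z, each correction to R(z, v)u is a multiple of the identity, a multiple of the
raised Hessian, or of rank one, so every trace is immediate. -/
theorem ricci_conformal (h : IsMetricAt G y) (hf : ContDiffAt ℝ 2 f y) (u v : E) :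
    ricci (conformal G f) y u v = ricci G y u v
      - (Module.finrank ℝ E - 2) * (hessian G f y u v - fderiv ℝ f y u * fderiv ℝ f y v)
      - (laplacian G f y + (Module.finrank ℝ E - 2) * fderiv ℝ f y (gradient G f y))
        * G y u v := by
  change LinearMap.trace ℝ E _ = LinearMap.trace ℝ E _ - _ - _
  have : ricciEndomorphism (conformal G f) y u v = ricciEndomorphism G y u v
      + ((hessian G f y).flip u).smulRight v - hessian G f y v u • LinearMap.id
      - G y v u • raise (G y) (hessian G f y)
      + (G y u : E →ₗ[ℝ] ℝ).smulRight (raise (G y) (hessian G f y) v)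
      + (fderiv ℝ f y v * fderiv ℝ f y u
          - G y v u * fderiv ℝ f y (gradient G f y)) • LinearMap.id
      - (fderiv ℝ f y u • (fderiv ℝ f y : E →ₗ[ℝ] ℝ)
          - fderiv ℝ f y (gradient G f y) • (G y u : E →ₗ[ℝ] ℝ)).smulRight v
      + (G y v u • (fderiv ℝ f y : E →ₗ[ℝ] ℝ)
          - fderiv ℝ f y v • (G y u : E →ₗ[ℝ] ℝ)).smulRight (gradient G f y) := by
    ext z
    simp [ricciEndomorphism, curvature_conformal h hf, h.symm_apply z u]
    module
  rw [this]
  simp [LinearMap.trace_smulRight, ← metricTrace_eq_trace_raise, h.apply_gradient',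
    h.symm_apply v u, h.symm_apply u (raise _ _ _), apply_raise h.isInvertible,
    h.hessian_symm hf v u, laplacian]
  ring

/-- Tracing `ricci_conformal` gives (n-2) + n = 2(n-1) copies of -Δf, and (n-2) - n(n-2) =
-(n-1)(n-2) copies of |∇f|². -/
theorem scalarCurvature_conformal (h : IsMetricAt G y) (hf : ContDiffAt ℝ 2 f y) :
    scalarCurvature (conformal G f) y = ((Real.exp (f y)) ^ 2)⁻¹ *
      (scalarCurvature G y - 2 * (Module.finrank ℝ E - 1) * laplacian G f y
        - (Module.finrank ℝ E - 1) * (Module.finrank ℝ E - 2)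
          * fderiv ℝ f y (gradient G f y)) := by
  rw [scalarCurvature, conformal, metricTrace_smul h.isInvertible (by positivity),
    metricTrace_eq_trace (T := ricci _ _) h.isInvertible
    (A := raise (G y) (ricci G y) - (Module.finrank ℝ E - 2 : ℝ) •
        (raise (G y) (hessian G f y) - (fderiv ℝ f y : E →ₗ[ℝ] ℝ).smulRight (gradient G f y))
      - (laplacian G f y + (Module.finrank ℝ E - 2) * fderiv ℝ f y (gradient G f y))
        • LinearMap.id)]
  · simp [LinearMap.trace_smulRight, ← metricTrace_eq_trace_raise, scalarCurvature, laplacian]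
    ring
  · intro u v
    rw [ricci_conformal h hf]
    simp [apply_raise h.isInvertible, h.apply_gradient]

end Conformal

/-! ### Gradient and Laplacian of log c. -/

section Logarithm

variable {E : Type*} [NormedAddCommGroup E] [NormedSpace ℝ E]
  {G : E → E →L[ℝ] E →L[ℝ] ℝ} {c : E → ℝ} {y : E}

theorem gradient_log (hc : DifferentiableAt ℝ c y) (hc0 : c y ≠ 0) :
    gradient G (fun x => Real.log (c x)) y = (c y)⁻¹ • gradient G c y := by
  rw [gradient, (hc.hasFDerivAt.log hc0).fderiv, map_smul, gradient]

/-- Trace of Hess(log c) = c⁻¹ Hess c - c⁻² dc ⊗ dc. -/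
theorem laplacian_log [FiniteDimensional ℝ E] (h : IsMetricAt G y) (hc : ContDiffAt ℝ 2 c y)
    (hc0 : c y ≠ 0) :
    laplacian G (fun x => Real.log (c x)) y =
      (c y)⁻¹ * laplacian G c y - ((c y) ^ 2)⁻¹ * fderiv ℝ c y (gradient G c y) := by
  have e : fderiv ℝ (fun x => Real.log (c x)) =ᶠ[𝓝 y] fun x => (c x)⁻¹ • fderiv ℝ c x := by
    filter_upwards [hc.eventually (by norm_num), hc.continuousAt.eventually_ne hc0] with x hx hx0
      using ((hx.differentiableAt (by norm_num)).hasFDerivAt.log hx0).fderiv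
  have hd : DifferentiableAt ℝ (fderiv ℝ c) y :=
    (hc.fderiv_right (m := 1) (by norm_num)).differentiableAt (by norm_num)
  have h1 := ((hasFDerivAt_inv hc0).comp y
    (hc.differentiableAt (by norm_num)).hasFDerivAt).smul hd.hasFDerivAt
  rw [laplacian, metricTrace_eq_trace h.isInvertible (A := (c y)⁻¹ • raise (G y) (hessian G c y)
    - ((c y) ^ 2)⁻¹ • (fderiv ℝ c y : E →ₗ[ℝ] ℝ).smulRight (gradient G c y))]
  · simp [LinearMap.trace_smulRight, ← metricTrace_eq_trace_raise, laplacian]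
  · intro u v
    simp [apply_raise h.isInvertible, h.apply_gradient]
    simp only [hessian, LinearMap.mk₂_apply, e.eq_of_nhds, (h1.congr_of_eventuallyEq e).fderiv]
    simp
    ring

end Logarithm

end LocalMetric

namespace LocalMetric

/-! ### Curvature of warped products. -/

section Product

variable {E E' : Type*} [NormedAddCommGroup E] [NormedSpace ℝ E]
  [NormedAddCommGroup E'] [NormedSpace ℝ E']

/-- The warped product metric `GB + w² GF` on the product. -/
def warped (GB : E → E →L[ℝ] E →L[ℝ] ℝ) (GF : E' → E' →L[ℝ] E' →L[ℝ] ℝ) (w : E → ℝ)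
    (y : E × E') : E × E' →L[ℝ] E × E' →L[ℝ] ℝ :=
  pullbackForm (ContinuousLinearMap.fst ℝ E E') (GB y.1)
    + (w y.1) ^ 2 • pullbackForm (ContinuousLinearMap.snd ℝ E E') (GF y.2)

variable {GB : E → E →L[ℝ] E →L[ℝ] ℝ} {GF : E' → E' →L[ℝ] E' →L[ℝ] ℝ} {w : E → ℝ} {y : E × E'}

theorem warped_apply (U V : E × E') :
    warped GB GF w y U V = GB y.1 U.1 V.1 + (w y.1) ^ 2 * GF y.2 U.2 V.2 := rfl

variable [FiniteDimensional ℝ E] [FiniteDimensional ℝ E']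

theorem trace_eq_add_trace_blocks (A : E × E' →ₗ[ℝ] E × E') :
    LinearMap.trace ℝ (E × E') A =
      LinearMap.trace ℝ E (LinearMap.fst ℝ E E' ∘ₗ A ∘ₗ LinearMap.inl ℝ E E') +
      LinearMap.trace ℝ E' (LinearMap.snd ℝ E E' ∘ₗ A ∘ₗ LinearMap.inr ℝ E E') := by
  have : A = LinearMap.inl ℝ E E' ∘ₗ (LinearMap.fst ℝ E E' ∘ₗ A) +
      LinearMap.inr ℝ E E' ∘ₗ (LinearMap.snd ℝ E E' ∘ₗ A) := by
    ext <;> simp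
  conv_lhs => rw [this]
  rw [map_add, LinearMap.trace_comp_comm' _ (LinearMap.inl ℝ E E'),
    LinearMap.trace_comp_comm' _ (LinearMap.inr ℝ E E')]
  rfl

theorem IsMetricAt.warped (hB : IsMetricAt GB y.1) (hF : IsMetricAt GF y.2)
    (hw : ContDiffAt ℝ 2 w y.1) (hw0 : w y.1 ≠ 0) : IsMetricAt (warped GB GF w) y where
  contDiffAt := by
    have h1 : ContDiffAt ℝ 2 (fun x : E × E' => GB x.1) y := hB.contDiffAt.comp y contDiffAt_fst
    have h2 : ContDiffAt ℝ 2 (fun x : E × E' => GF x.2) y := hF.contDiffAt.comp y contDiffAt_snd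
    have h3 : ContDiffAt ℝ 2 (fun x : E × E' => w x.1) y := hw.comp y contDiffAt_fst
    exact (contDiffAt_const.clm_comp (h1.clm_comp contDiffAt_const)).add
      ((h3.pow 2).smul (contDiffAt_const.clm_comp (h2.clm_comp contDiffAt_const)))
  symm := by
    filter_upwards [continuousAt_fst.eventually hB.symm, continuousAt_snd.eventually hF.symm]
      with x h1 h2 U V
    rw [warped_apply, warped_apply, h1, h2]
  isInvertible := by
    refine isInvertible_of_nondegenerate _ fun U hU => Prod.ext ?_ ?_
    · refine eq_of_form_eq hB.isInvertible fun v => ?_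
      simpa [warped_apply] using hU (v, 0)
    · refine eq_of_form_eq hF.isInvertible fun v => ?_
      simpa [warped_apply, hw0] using hU (0, v)

/-- The two factors are orthogonal, so mixed components of T do not enter the trace. For the scalar
curvature this makes the mixed Ricci components unnecessary. -/
theorem metricTrace_warped (hB : (GB y.1).IsInvertible) (hF : (GF y.2).IsInvertible)
    (h : (warped GB GF w y).IsInvertible) (hw0 : w y.1 ≠ 0)
    (T : E × E' →ₗ[ℝ] E × E' →ₗ[ℝ] ℝ) :
    metricTrace (warped GB GF w y) T =
      metricTrace (GB y.1) (T.compl₁₂ (LinearMap.inl ℝ E E') (LinearMap.inl ℝ E E')) +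
      ((w y.1) ^ 2)⁻¹ *
        metricTrace (GF y.2) (T.compl₁₂ (LinearMap.inr ℝ E E') (LinearMap.inr ℝ E E')) := by
  rw [metricTrace_eq_trace_raise, trace_eq_add_trace_blocks]
  congr 1
  · refine (metricTrace_eq_trace hB fun u v => ?_).symm
    have := apply_raise h T (u, 0) (v, 0)
    simpa [warped_apply] using this
  · rw [← metricTrace_smul hF (by positivity)]
    refine (metricTrace_eq_trace (isInvertible_smul hF (by positivity)) fun u v => ?_).symm
    have := apply_raise h T (0, u) (0, v)
    simpa [warped_apply] using this

theorem fderiv_warped (hB : IsMetricAt GB y.1) (hF : IsMetricAt GF y.2)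
    (hw : ContDiffAt ℝ 2 w y.1) (hw0 : w y.1 ≠ 0) (Z U V : E × E') :
    fderiv ℝ (warped GB GF w) y Z U V = fderiv ℝ GB y.1 Z.1 U.1 V.1
      + 2 * w y.1 * fderiv ℝ w y.1 Z.1 * GF y.2 U.2 V.2
      + (w y.1) ^ 2 * fderiv ℝ GF y.2 Z.2 U.2 V.2 := by
  have h0 := ((hB.warped hF hw hw0).differentiableAt.hasFDerivAt.clm_apply
    (hasFDerivAt_const U y)).clm_apply (hasFDerivAt_const V y)
  have hw1 := (hw.differentiableAt (by norm_num)).hasFDerivAt.comp y (hasFDerivAt_fst (𝕜 := ℝ))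
  have hB1 := ((hB.differentiableAt.hasFDerivAt.comp y hasFDerivAt_fst).clm_apply
    (hasFDerivAt_const U.1 y)).clm_apply (hasFDerivAt_const V.1 y)
  have hF1 := ((hF.differentiableAt.hasFDerivAt.comp y hasFDerivAt_snd).clm_apply
    (hasFDerivAt_const U.2 y)).clm_apply (hasFDerivAt_const V.2 y)
  have h1 := hB1.add ((hw1.pow 2).mul hF1)
  -- Two derivatives of the same scalar function, G(U, V) with U and V constant, must agree.
  have := congrArg (fun L : E × E' →L[ℝ] ℝ => L Z) (h0.unique h1)
  simp at this
  rw [this]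
  ring

/-- In the Koszul formula the only coupling is through the derivative of w². Paired with a base
vector it produces the multiple of ∇w; paired with a fibre vector, the two terms in w⁻¹ dw. -/
theorem christoffel_warped (hB : IsMetricAt GB y.1) (hF : IsMetricAt GF y.2)
    (hw : ContDiffAt ℝ 2 w y.1) (hw0 : w y.1 ≠ 0) (U V : E × E') :
    christoffel (warped GB GF w) y U V =
      (christoffel GB y.1 U.1 V.1 - (w y.1 * GF y.2 U.2 V.2) • gradient GB w y.1,
        christoffel GF y.2 U.2 V.2 + ((w y.1)⁻¹ * fderiv ℝ w y.1 U.1) • V.2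
          + ((w y.1)⁻¹ * fderiv ℝ w y.1 V.1) • U.2) := by
  have h := hB.warped hF hw hw0
  refine eq_of_form_eq h.isInvertible fun Z => ?_
  rw [h.apply_christoffel]
  simp only [fderiv_warped hB hF hw hw0, warped_apply]
  simp only [map_add, map_sub, map_smul, add_apply, sub_apply, smul_apply, smul_eq_mul,
    hB.apply_christoffel, hF.apply_christoffel, hB.apply_gradient]
  field_simp
  ring

theorem fderiv_christoffel_warped (hB : IsMetricAt GB y.1) (hF : IsMetricAt GF y.2)
    (hw : ContDiffAt ℝ 2 w y.1) (hw0 : w y.1 ≠ 0) (Z U V : E × E') :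
    fderiv ℝ (christoffel (warped GB GF w)) y Z U V =
      (fderiv ℝ (christoffel GB) y.1 Z.1 U.1 V.1
        - (fderiv ℝ w y.1 Z.1 * GF y.2 U.2 V.2
            + w y.1 * fderiv ℝ GF y.2 Z.2 U.2 V.2) • gradient GB w y.1
        - (w y.1 * GF y.2 U.2 V.2) • fderiv ℝ (gradient GB w) y.1 Z.1,
       fderiv ℝ (christoffel GF) y.2 Z.2 U.2 V.2
        + ((w y.1)⁻¹ * fderiv ℝ (fderiv ℝ w) y.1 Z.1 U.1
            - ((w y.1) ^ 2)⁻¹ * fderiv ℝ w y.1 Z.1 * fderiv ℝ w y.1 U.1) • V.2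
        + ((w y.1)⁻¹ * fderiv ℝ (fderiv ℝ w) y.1 Z.1 V.1
            - ((w y.1) ^ 2)⁻¹ * fderiv ℝ w y.1 Z.1 * fderiv ℝ w y.1 V.1) • U.2) := by
  have h := hB.warped hF hw hw0
  have e : (fun x => christoffel (warped GB GF w) x U V) =ᶠ[𝓝 y] fun x =>
      (christoffel GB x.1 U.1 V.1 - (w x.1 * GF x.2 U.2 V.2) • gradient GB w x.1,
        christoffel GF x.2 U.2 V.2 + ((w x.1)⁻¹ * fderiv ℝ w x.1 U.1) • V.2
          + ((w x.1)⁻¹ * fderiv ℝ w x.1 V.1) • U.2) := by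
    filter_upwards [continuousAt_fst.eventually hB.eventually,
      continuousAt_snd.eventually hF.eventually,
      continuousAt_fst.eventually (hw.eventually (by norm_num)),
      continuousAt_fst.eventually (hw.continuousAt.eventually_ne hw0)] with x h1 h2 h3 h4
      using christoffel_warped h1 h2 h3 h4 U V
  have hfst : HasFDerivAt Prod.fst (ContinuousLinearMap.fst ℝ E E') y := hasFDerivAt_fst
  have hsnd : HasFDerivAt Prod.snd (ContinuousLinearMap.snd ℝ E E') y := hasFDerivAt_snd
  have hd : DifferentiableAt ℝ (fderiv ℝ w) y.1 :=
    (hw.fderiv_right (m := 1) (by norm_num)).differentiableAt (by norm_num)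
  have h1 := ((hB.differentiableAt_christoffel.hasFDerivAt.comp y hfst).clm_apply
    (hasFDerivAt_const U.1 y)).clm_apply (hasFDerivAt_const V.1 y)
  have h2 := ((hF.differentiableAt_christoffel.hasFDerivAt.comp y hsnd).clm_apply
    (hasFDerivAt_const U.2 y)).clm_apply (hasFDerivAt_const V.2 y)
  have h3 := ((hF.differentiableAt.hasFDerivAt.comp y hsnd).clm_apply
    (hasFDerivAt_const U.2 y)).clm_apply (hasFDerivAt_const V.2 y)
  have h4 (u : E) := (hd.hasFDerivAt.comp y hfst).clm_apply (hasFDerivAt_const u y)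
  have h5 := (hw.differentiableAt (by norm_num)).hasFDerivAt.comp y hfst
  have h6 := (hasFDerivAt_inv hw0).comp y h5
  have h7 := (hB.differentiableAt_gradient hw).hasFDerivAt.comp y hfst
  have h8 := (h1.sub ((h5.mul h3).smul h7)).prodMk
    ((h2.add ((h6.mul (h4 U.1)).smul (hasFDerivAt_const V.2 y))).add
      ((h6.mul (h4 V.1)).smul (hasFDerivAt_const U.2 y)))
  rw [h.fderiv_christoffel_apply, (h8.congr_of_eventuallyEq e).fderiv]
  refine Prod.ext ?_ ?_
  · simp
    module
  · simp
    module

/-- The base block of the Ricci endomorphism is that of the base. The fibre block is -w⁻¹ Hess w (v,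
u) times the identity, whence the factor dim F. -/
theorem ricci_warped_base (hB : IsMetricAt GB y.1) (hF : IsMetricAt GF y.2)
    (hw : ContDiffAt ℝ 2 w y.1) (hw0 : w y.1 ≠ 0) (u v : E) :
    ricci (warped GB GF w) y (u, 0) (v, 0) = ricci GB y.1 u v
      - Module.finrank ℝ E' * (w y.1)⁻¹ * hessian GB w y.1 u v := by
  change LinearMap.trace ℝ (E × E') _ = LinearMap.trace ℝ E _ - _
  have h1 : LinearMap.fst ℝ E E' ∘ₗ ricciEndomorphism (warped GB GF w) y (u, 0) (v, 0) ∘ₗ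
      LinearMap.inl ℝ E E' = ricciEndomorphism GB y.1 u v := by
    ext z
    simp [ricciEndomorphism, curvature, christoffel_warped hB hF hw hw0,
      fderiv_christoffel_warped hB hF hw hw0]
  have h2 : LinearMap.snd ℝ E E' ∘ₗ ricciEndomorphism (warped GB GF w) y (u, 0) (v, 0) ∘ₗ
      LinearMap.inr ℝ E E' = (-(w y.1)⁻¹ * hessian GB w y.1 v u) • LinearMap.id := by
    ext d
    simp [ricciEndomorphism, curvature, christoffel_warped hB hF hw hw0,
      fderiv_christoffel_warped hB hF hw hw0, hessian]
    module
  rw [trace_eq_add_trace_blocks, h1, h2, hB.hessian_symm hw u v]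
  simp
  ring

/-- The base block is a multiple of the raised Hessian of w and yields -w Δw. The fibre block
corrects the fibre curvature by |∇w|² times a rank one map minus a multiple of the identity, whose
trace gives 1 - dim F. -/
theorem ricci_warped_fiber (hB : IsMetricAt GB y.1) (hF : IsMetricAt GF y.2)
    (hw : ContDiffAt ℝ 2 w y.1) (hw0 : w y.1 ≠ 0) (a b : E') :
    ricci (warped GB GF w) y (0, a) (0, b) = ricci GF y.2 a b
      - (w y.1 * laplacian GB w y.1
          + (Module.finrank ℝ E' - 1) * fderiv ℝ w y.1 (gradient GB w y.1)) * GF y.2 a b := by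
  change LinearMap.trace ℝ (E × E') _ = LinearMap.trace ℝ E' _ - _
  have h1 : LinearMap.fst ℝ E E' ∘ₗ ricciEndomorphism (warped GB GF w) y (0, a) (0, b) ∘ₗ
      LinearMap.inl ℝ E E' = (-w y.1 * GF y.2 b a) • raise (GB y.1) (hessian GB w y.1) := by
    ext z
    simp [ricciEndomorphism, curvature, christoffel_warped hB hF hw hw0,
      fderiv_christoffel_warped hB hF hw hw0, ← hB.fderiv_gradient hw]
    match_scalars <;> field_simp
    ring
  have h2 : LinearMap.snd ℝ E E' ∘ₗ ricciEndomorphism (warped GB GF w) y (0, a) (0, b) ∘ₗ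
      LinearMap.inr ℝ E E' = ricciEndomorphism GF y.2 a b
        - (fderiv ℝ w y.1 (gradient GB w y.1) * GF y.2 b a) • LinearMap.id
        + fderiv ℝ w y.1 (gradient GB w y.1) • (GF y.2 a : E' →ₗ[ℝ] ℝ).smulRight b := by
    ext d
    simp [ricciEndomorphism, curvature, christoffel_warped hB hF hw hw0,
      fderiv_christoffel_warped hB hF hw hw0, hF.symm_apply d a]
    match_scalars <;> field_simp
  rw [trace_eq_add_trace_blocks, h1, h2]
  simp [LinearMap.trace_smulRight, ← metricTrace_eq_trace_raise, laplacian, hF.symm_apply b a]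
  ring

/-- Base and fibre traces each contribute -k w⁻¹ Δw, with k = dim F; hence the factor 2. -/
theorem scalarCurvature_warped (hB : IsMetricAt GB y.1) (hF : IsMetricAt GF y.2)
    (hw : ContDiffAt ℝ 2 w y.1) (hw0 : w y.1 ≠ 0) :
    scalarCurvature (warped GB GF w) y = scalarCurvature GB y.1
      + ((w y.1) ^ 2)⁻¹ * scalarCurvature GF y.2
      - 2 * Module.finrank ℝ E' * (w y.1)⁻¹ * laplacian GB w y.1
      - Module.finrank ℝ E' * (Module.finrank ℝ E' - 1) * ((w y.1) ^ 2)⁻¹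
          * fderiv ℝ w y.1 (gradient GB w y.1) := by
  rw [scalarCurvature, metricTrace_warped hB.isInvertible hF.isInvertible
    (hB.warped hF hw hw0).isInvertible hw0,
    metricTrace_eq_trace hB.isInvertible (A := raise (GB y.1) (ricci GB y.1)
      - (Module.finrank ℝ E' * (w y.1)⁻¹) • raise (GB y.1) (hessian GB w y.1)),
    metricTrace_eq_trace hF.isInvertible (A := raise (GF y.2) (ricci GF y.2)
      - (w y.1 * laplacian GB w y.1
          + (Module.finrank ℝ E' - 1) * fderiv ℝ w y.1 (gradient GB w y.1)) • LinearMap.id)]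
  · simp [← metricTrace_eq_trace_raise, scalarCurvature, laplacian]
    field_simp
    ring
  · intro a b
    simp [apply_raise hF.isInvertible, ricci_warped_fiber hB hF hw hw0]
  · intro u v
    simp [apply_raise hB.isInvertible, ricci_warped_base hB hF hw hw0]

end Product

end LocalMetric

namespace PseudoRiemannianMetric

/-! ### From manifolds to their preferred charts. -/

section Chart

variable {E : Type*} [NormedAddCommGroup E] [NormedSpace ℝ E]
  {H : Type*} [TopologicalSpace H] {I : ModelWithCorners ℝ E H} [I.Boundaryless]
  {M : Type*} [TopologicalSpace M] [ChartedSpace H M]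

theorem mdifferentiableAt_extChartAt_symm [IsManifold I ∞ M] {x : M} {y : E}
    (hy : y ∈ (extChartAt I x).target) :
    MDifferentiableAt 𝓘(ℝ, E) I (extChartAt I x).symm y := by
  have : IsManifold I 1 M := .of_le (n := ∞) (by simp)
  have h := mdifferentiableWithinAt_extChartAt_symm hy
  rwa [I.range_eq_univ, mdifferentiableWithinAt_univ] at h

theorem contDiffAt_comp_extChartAt_symm [IsManifold I ∞ M] {V : Type*} [NormedAddCommGroup V]
    [NormedSpace ℝ V] {f : M → V} {x : M} (hf : ContMDiffAt I 𝓘(ℝ, V) ∞ f x) :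
    ContDiffAt ℝ 2 (f ∘ (extChartAt I x).symm) (extChartAt I x x) := by
  have h1 : ContMDiffAt 𝓘(ℝ, E) I ∞ (extChartAt I x).symm (extChartAt I x x) :=
    (contMDiffOn_extChartAt_symm x).contMDiffAt (extChartAt_target_mem_nhds x)
  have h2 := ContMDiffAt.comp (I' := I) (extChartAt I x x) (g := f)
    (by rwa [extChartAt_to_inv]) h1
  exact (contMDiffAt_iff_contDiffAt.1 h2).of_le (WithTop.coe_le_coe.2 (le_top : (2 : ℕ∞) ≤ ⊤))

theorem fderiv_comp_extChartAt_symm [IsManifold I ∞ M] {f : M → ℝ} {x : M}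
    (hf : ContMDiffAt I 𝓘(ℝ, ℝ) ∞ f x) :
    fderiv ℝ (f ∘ (extChartAt I x).symm) (extChartAt I x x) = mfderiv I 𝓘(ℝ, ℝ) f x := by
  rw [(hf.mdifferentiableAt (by simp)).mfderiv, I.range_eq_univ, fderivWithin_univ]
  rfl

variable [IsManifold I ∞ M] (g : PseudoRiemannianMetric I M)

theorem inChart_self (x : M) : g.inChart x (extChartAt I x x) = g.form x := by
  have : IsManifold I 1 M := .of_le (n := ∞) (by simp)
  -- The base point of the pulled-back form equals x only propositionally and its type depends on
  -- that point, so the point is generalized before substitution.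
  have key (x' : M) (hx' : x' = x) (A : E →L[ℝ] E) (hA : A = .id ℝ E) :
      pullbackForm (V := TangentSpace I x') (W := E) A (g.form x') = g.form x := by
    subst hx' hA
    rfl
  refine key _ (extChartAt_to_inv x) _ ?_
  have h := mfderivWithin_range_extChartAt_symm (I := I) (x := x)
  rw [I.range_eq_univ, mfderivWithin_univ] at h
  exact h

/-- The inverse of the tangent bundle trivialization at x is the derivative of the inverse chart.
Hence the metric in the chart is the smooth section read in that trivialization. -/
theorem contDiffAt_inChart (x : M) : ContDiffAt ℝ 2 (g.inChart x) (extChartAt I x x) := by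
  have : IsManifold I 1 M := .of_le (n := ∞) (by simp)
  have h1 := contDiffAt_comp_extChartAt_symm ((contMDiffAt_hom_bundle _).1 (g.contMDiff x)).2
  refine h1.congr_of_eventuallyEq ?_
  filter_upwards [extChartAt_target_mem_nhds (I := I) x] with y hy
  ext u v
  have hm : (extChartAt I x).symm y ∈ (trivializationAt E (TangentSpace I) x).baseSet := by
    simpa using (extChartAt I x).map_target hy
  have hsymm (u : E) : (trivializationAt E (TangentSpace I) x).symm ((extChartAt I x).symm y) u =
      mfderiv 𝓘(ℝ, E) I (extChartAt I x).symm y u := by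
    have h := TangentBundle.symmL_trivializationAt (I := I)
      (show (extChartAt I x).symm y ∈ (chartAt H x).source by
        simpa using (extChartAt I x).map_target hy)
    rw [(extChartAt I x).right_inv hy, I.range_eq_univ, mfderivWithin_univ] at h
    exact (Bundle.Trivialization.symmL_apply (R := ℝ) _ hm u).symm.trans
      (congrArg (fun L : E →L[ℝ] E => L u) h)
  change _ = ContinuousLinearMap.inCoordinates E (TangentSpace I) (E →L[ℝ] ℝ)
    (fun b => TangentSpace I b →L[ℝ] ℝ) x ((extChartAt I x).symm y) x ((extChartAt I x).symm y)
      (g.form ((extChartAt I x).symm y)) u v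
  rw [inCoordinates_apply_eq₂ hm hm (by simp), hsymm, hsymm]
  simp
  rfl

theorem isMetricAt_inChart [FiniteDimensional ℝ E] (x : M) :
    LocalMetric.IsMetricAt (g.inChart x) (extChartAt I x x) where
  contDiffAt := g.contDiffAt_inChart x
  symm := .of_forall fun y u v => g.symm _ _ _
  isInvertible := by
    rw [inChart_self]
    exact LocalMetric.isInvertible_of_nondegenerate (E := E) (g.form x) (g.nondegenerate x)

theorem form_gradient_gradient [FiniteDimensional ℝ E] {f k : M → ℝ} {x : M}
    (hf : ContMDiffAt I 𝓘(ℝ, ℝ) ∞ f x) (hk : ContMDiffAt I 𝓘(ℝ, ℝ) ∞ k x) :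
    g.form x (g.gradient f x) (g.gradient k x) =
      fderiv ℝ (f ∘ (extChartAt I x).symm) (extChartAt I x x)
        (LocalMetric.gradient (g.inChart x) (k ∘ (extChartAt I x).symm) (extChartAt I x x)) := by
  have h : LocalMetric.gradient (g.inChart x) (k ∘ (extChartAt I x).symm) (extChartAt I x x) =
      g.gradient k x := by
    rw [LocalMetric.gradient, inChart_self, fderiv_comp_extChartAt_symm hk]
    rfl
  rw [h, fderiv_comp_extChartAt_symm hf]
  exact g.gradient_spec f x _

end Chart

/-! ### Product charts and the base conformal warped product. -/

section Product

variable {E : Type*} [NormedAddCommGroup E] [NormedSpace ℝ E]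
  {H : Type*} [TopologicalSpace H] {I : ModelWithCorners ℝ E H} [I.Boundaryless]
  {B : Type*} [TopologicalSpace B] [ChartedSpace H B] [IsManifold I ∞ B]
  {E' : Type*} [NormedAddCommGroup E'] [NormedSpace ℝ E']
  {H' : Type*} [TopologicalSpace H'] {J : ModelWithCorners ℝ E' H'} [J.Boundaryless]
  {F : Type*} [TopologicalSpace F] [ChartedSpace H' F] [IsManifold J ∞ F]

/-- The inverse product chart followed by the projection is the projection followed by the inverse
base chart; the chain rule is applied to both composites. -/
theorem mfderiv_fst_mfderiv_extChartAt_symm {p : B} {q : F} {y : E × E'}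
    (hy : y ∈ (extChartAt (I.prod J) (p, q)).target) (U : E × E') :
    mfderiv (I.prod J) I Prod.fst ((extChartAt (I.prod J) (p, q)).symm y)
      (mfderiv 𝓘(ℝ, E × E') (I.prod J) (extChartAt (I.prod J) (p, q)).symm y U) =
      mfderiv 𝓘(ℝ, E) I (extChartAt I p).symm y.1 U.1 := by
  have hy' : y.1 ∈ (extChartAt I p).target := by
    rw [extChartAt_prod] at hy
    exact hy.1
  have h1 := mfderiv_comp y (mdifferentiableAt_fst (I := I) (I' := J))
    (mdifferentiableAt_extChartAt_symm hy)
  have h2 := mfderiv_comp (I := 𝓘(ℝ, E × E')) (f := (Prod.fst : E × E' → E)) y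
    (mdifferentiableAt_extChartAt_symm hy') differentiableAt_fst.mdifferentiableAt
  have h3 : (Prod.fst : B × F → B) ∘ (extChartAt (I.prod J) (p, q)).symm =
      (extChartAt I p).symm ∘ Prod.fst := by
    rw [extChartAt_prod]
    rfl
  rw [mfderiv_eq_fderiv, fderiv_fst] at h2
  have h4 := (mfderiv_congr (I := 𝓘(ℝ, E × E')) (I' := I) (x := y) h3)
  exact congrArg (fun L : E × E' →L[ℝ] E => L U) (h1.symm.trans (h4.trans h2))

theorem mfderiv_snd_mfderiv_extChartAt_symm {p : B} {q : F} {y : E × E'}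
    (hy : y ∈ (extChartAt (I.prod J) (p, q)).target) (U : E × E') :
    mfderiv (I.prod J) J Prod.snd ((extChartAt (I.prod J) (p, q)).symm y)
      (mfderiv 𝓘(ℝ, E × E') (I.prod J) (extChartAt (I.prod J) (p, q)).symm y U) =
      mfderiv 𝓘(ℝ, E') J (extChartAt J q).symm y.2 U.2 := by
  have hy' : y.2 ∈ (extChartAt J q).target := by
    rw [extChartAt_prod] at hy
    exact hy.2
  have h1 := mfderiv_comp y (mdifferentiableAt_snd (I := I) (I' := J))
    (mdifferentiableAt_extChartAt_symm hy)
  have h2 := mfderiv_comp (I := 𝓘(ℝ, E × E')) (f := (Prod.snd : E × E' → E')) y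
    (mdifferentiableAt_extChartAt_symm hy') differentiableAt_snd.mdifferentiableAt
  have h3 : (Prod.snd : B × F → F) ∘ (extChartAt (I.prod J) (p, q)).symm =
      (extChartAt J q).symm ∘ Prod.snd := by
    rw [extChartAt_prod]
    rfl
  rw [mfderiv_eq_fderiv, fderiv_snd] at h2
  have h4 := (mfderiv_congr (I := 𝓘(ℝ, E × E')) (I' := J) (x := y) h3)
  exact congrArg (fun L : E × E' →L[ℝ] E' => L U) (h1.symm.trans (h4.trans h2))

/-- In product coordinates a base conformal warped product is a warped product over a conformally
changed base. -/
theorem inChart_bcwp_eventuallyEq (gB : PseudoRiemannianMetric I B)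
    (gF : PseudoRiemannianMetric J F) {c w : B → ℝ} (hc : ContMDiff I 𝓘(ℝ, ℝ) ∞ c)
    (hw : ContMDiff I 𝓘(ℝ, ℝ) ∞ w) (hc0 : ∀ p, 0 < c p) (hw0 : ∀ p, 0 < w p) (p : B) (q : F) :
    (gB.bcwp gF c w hc hw hc0 hw0).inChart (p, q) =ᶠ[𝓝 (extChartAt I p p, extChartAt J q q)]
      LocalMetric.warped
        (LocalMetric.conformal (gB.inChart p) fun x => Real.log ((c ∘ (extChartAt I p).symm) x))
        (gF.inChart q) (w ∘ (extChartAt I p).symm) := by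
  have ht := extChartAt_target_mem_nhds (I := I.prod J) ((p, q) : B × F)
  filter_upwards [ht] with y hy
  refine ContinuousLinearMap.ext fun U => ContinuousLinearMap.ext fun V => ?_
  refine (bcwpForm_apply gB gF c w _ _ _).trans ?_
  refine (congrArg₂ (· + ·)
    (congrArg₂ (fun a b : E => (c ((extChartAt I p).symm y.1)) ^ 2 *
        gB.form ((extChartAt I p).symm y.1) a b)
      (mfderiv_fst_mfderiv_extChartAt_symm hy U) (mfderiv_fst_mfderiv_extChartAt_symm hy V))
    (congrArg₂ (fun a b : E' => (w ((extChartAt I p).symm y.1)) ^ 2 *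
        gF.form ((extChartAt J q).symm y.2) a b)
      (mfderiv_snd_mfderiv_extChartAt_symm hy U)
      (mfderiv_snd_mfderiv_extChartAt_symm hy V))).trans ?_
  rw [LocalMetric.warped_apply, LocalMetric.conformal, Function.comp_apply, Real.exp_log (hc0 _)]
  rfl

end Product

end PseudoRiemannianMetric

namespace LocalMetric

/-- With f = log c and m = dim E, the term in Δf contributes 2(m-1) and the term in |∇f|²
contributes -(m-1)(m-2) to the coefficient of |∇c|²/c²; the sum is -(m-4)(m-1). The mixed term comes
from the Laplacian of w for the conformal metric. -/
theorem sq_mul_scalarCurvature_warped_conformal {E E' : Type*}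
    [NormedAddCommGroup E] [NormedSpace ℝ E] [FiniteDimensional ℝ E]
    [NormedAddCommGroup E'] [NormedSpace ℝ E'] [FiniteDimensional ℝ E']
    {GB : E → E →L[ℝ] E →L[ℝ] ℝ} {GF : E' → E' →L[ℝ] E' →L[ℝ] ℝ} {c w : E → ℝ} {y : E × E'}
    (hB : IsMetricAt GB y.1) (hF : IsMetricAt GF y.2)
    (hc : ContDiffAt ℝ 2 c y.1) (hw : ContDiffAt ℝ 2 w y.1) (hc0 : 0 < c y.1) (hw0 : w y.1 ≠ 0) :
    (c y.1) ^ 2 *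
        scalarCurvature (warped (conformal GB fun x => Real.log (c x)) GF w) y =
      scalarCurvature GB y.1 + scalarCurvature GF y.2 * ((c y.1) ^ 2 / (w y.1) ^ 2)
        - 2 * ((Module.finrank ℝ E : ℝ) - 1) * (laplacian GB c y.1 / c y.1)
        - 2 * (Module.finrank ℝ E' : ℝ) * (laplacian GB w y.1 / w y.1)
        - ((Module.finrank ℝ E : ℝ) - 4) * ((Module.finrank ℝ E : ℝ) - 1)
          * (fderiv ℝ c y.1 (gradient GB c y.1) / (c y.1) ^ 2)
        - 2 * (Module.finrank ℝ E' : ℝ) * ((Module.finrank ℝ E : ℝ) - 2)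
          * (fderiv ℝ w y.1 (gradient GB c y.1) / (w y.1 * c y.1))
        - (Module.finrank ℝ E' : ℝ) * ((Module.finrank ℝ E' : ℝ) - 1)
          * (fderiv ℝ w y.1 (gradient GB w y.1) / (w y.1) ^ 2) := by
  have hd : DifferentiableAt ℝ c y.1 := hc.differentiableAt (by norm_num)
  have hf : ContDiffAt ℝ 2 (fun x => Real.log (c x)) y.1 := hc.log hc0.ne'
  rw [scalarCurvature_warped (hB.conformal hf) hF hw hw0, scalarCurvature_conformal hB hf,
    laplacian_conformal hB hf, gradient_conformal hB, Real.exp_log hc0,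
    (hd.hasFDerivAt.log hc0.ne').fderiv, laplacian_log hB hc hc0.ne', gradient_log hd hc0.ne']
  simp only [smul_apply, map_smul, smul_eq_mul]
  field_simp
  ring

end LocalMetric

end

theorem mainTheorem4 (m k : ℕ)
    {B : Type*} [TopologicalSpace B] [ChartedSpace (EuclideanSpace ℝ (Fin m)) B]
    [IsManifold (𝓡 m) ∞ B]
    {F : Type*} [TopologicalSpace F] [ChartedSpace (EuclideanSpace ℝ (Fin k)) F]
    [IsManifold (𝓡 k) ∞ F]
    (gB : PseudoRiemannianMetric (𝓡 m) B) (gF : PseudoRiemannianMetric (𝓡 k) F)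
    (c w : B → ℝ) (hc : ContMDiff (𝓡 m) 𝓘(ℝ, ℝ) ∞ c) (hw : ContMDiff (𝓡 m) 𝓘(ℝ, ℝ) ∞ w)
    (hc0 : ∀ p, 0 < c p) (hw0 : ∀ p, 0 < w p) (p : B) (q : F) :
    (c p) ^ 2 * (gB.bcwp gF c w hc hw hc0 hw0).scalarCurvature (p, q) =
      gB.scalarCurvature p + gF.scalarCurvature q * ((c p) ^ 2 / (w p) ^ 2)
        - 2 * ((m : ℝ) - 1) * (gB.laplacian c p / c p)
        - 2 * (k : ℝ) * (gB.laplacian w p / w p)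
        - ((m : ℝ) - 4) * ((m : ℝ) - 1)
          * (gB.form p (gB.gradient c p) (gB.gradient c p) / (c p) ^ 2)
        - 2 * (k : ℝ) * ((m : ℝ) - 2)
          * (gB.form p (gB.gradient w p) (gB.gradient c p) / (w p * c p))
        - (k : ℝ) * ((k : ℝ) - 1)
          * (gB.form p (gB.gradient w p) (gB.gradient w p) / (w p) ^ 2) := by
  have hcp : c ((extChartAt (𝓡 m) p).symm (extChartAt (𝓡 m) p p)) = c p :=
    congrArg c (extChartAt_to_inv p)
  have hwp : w ((extChartAt (𝓡 m) p).symm (extChartAt (𝓡 m) p p)) = w p :=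
    congrArg w (extChartAt_to_inv p)
  -- The preferred chart at (p, q) is the product of the preferred charts, so this pair is the
  -- coordinate point of (p, q).
  have h := LocalMetric.sq_mul_scalarCurvature_warped_conformal
    (y := (extChartAt (𝓡 m) p p, extChartAt (𝓡 k) q q))
    (gB.isMetricAt_inChart p) (gF.isMetricAt_inChart q)
    (PseudoRiemannianMetric.contDiffAt_comp_extChartAt_symm (hc.contMDiffAt (x := p)))
    (PseudoRiemannianMetric.contDiffAt_comp_extChartAt_symm (hw.contMDiffAt (x := p)))
    (hc0 _) (hw0 _).ne'
  rw [← LocalMetric.scalarCurvature_congr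
      (PseudoRiemannianMetric.inChart_bcwp_eventuallyEq gB gF hc hw hc0 hw0 p q),
    ← PseudoRiemannianMetric.form_gradient_gradient gB hc.contMDiffAt hc.contMDiffAt,
    ← PseudoRiemannianMetric.form_gradient_gradient gB hw.contMDiffAt hc.contMDiffAt,
    ← PseudoRiemannianMetric.form_gradient_gradient gB hw.contMDiffAt hw.contMDiffAt] at h
  simp only [Function.comp_apply, hcp, hwp, finrank_euclideanSpace_fin] at h
  exact h
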